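/- Consider a time-slotted system of $N$ terminals that share one uplink to a base station. In each slot a packet is generated at terminal $n$ with probability $\lambda_n\in(0,1]$, independently over terminals and slots; every terminal stores its packets in a buffer of size $B\in\{1,2,\dots\}\cup\{\infty\}$. In each slot a policy chooses a set of terminals to be scheduled, the stored packet each of them transmits, and the packets that are discarded. The transmission succeeds if and only if exactly one terminal is scheduled and it has a packet to transmit. Packets generated in a slot arrive after the transmission of that slot, and can be transmitted from the next slot on, when their age is counted as $0$. The age of information (AoI) $h_{n,\pi}(t)$ of terminal $n$ under policy $\pi$ satisfies $h_{n,\pi}(t+1)=h_{n,\pi}(t)-r_n(t)+1$, where $r_n(t)$ is $h_{n,\pi}(t)$ minus the age of the delivered packet if a packet of terminal $n$ that is fresher than the current AoI is delivered in slot $t$, and $r_n(t)=0$ otherwise; buffers are empty initially and the initial AoIs are arbitrary nonnegative integers. Policies may be randomized and may use any information, including all future arrivals (non-causal policies). The time-average AoI of $\pi$ is $\bar h_\pi=\lim_{T\to\infty}\frac1{TN}\sum_{t=1}^{T}\sum_{n=1}^N h_{n,\pi}(t)$ (the expectation of the $\liminf$, if the limit does not exist or is random). Let $\bar h_{\mathrm{opt}}$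 be its infimum over all policies. Let $\bar h_{\mathsf{RR}}$ be its value for RR-ONE, the policy which in every slot schedules the terminal for which the time since it was last scheduled is largest (the smallest index in case of ties), and which keeps at each terminal only the latest packet. RR-ONE is asymptotically optimal among all policies. Precisely, RR-ONE is admissible for every such $B$, and for all $\lambda_n\in(0,1]$ the limit defining $\bar h_{\mathsf{RR}}$ exists almost surely and is a constant. Moreover: (1) Let arrival probabilities $\lambda_1^{(N)},\dots,\lambda_N^{(N)}\in(0,1]$ be given for every $N$ such that $\frac1{N^2}\sum_{n=1}^N 1/\lambda_n^{(N)}\to0$ as $N\to\infty$ (for instance, arrival probabilities that are bounded below by a positive constant). Then $$\lim_{N\to\infty}\frac{\bar h_{\mathsf{RR}}}{N}=\lim_{N\to\infty}\frac{\bar h_{\mathrm{opt}}}{N}=\frac12 .$$ (2) For every $N$, every $i\in\{1,\dots,N\}$ and all fixed $\lambda_j\in(0,1]$, $j\ne i$, $$\lim_{1/\lambda_i\to\infty}\lambda_i\,\bar h_{\mathsf{RR}}=\lim_{1/\lambda_i\to\infty}\lambda_i\,\bar h_{\mathrm{opt}}=\frac1N .$$ -/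

import Mathlib

open MeasureTheory ProbabilityTheory Filter unitInterval
open scoped ENNReal Topology

namespace Uplink

/-- Sample points for `N` terminals: `ω.1 t n = true` iff a packet is generated at terminal `n` in
slot `t` (slots are numbered `0, 1, 2, …`), and `ω.2` is a seed that a policy may use to
randomize. -/
abbrev Outcome (N : ℕ) : Type := (ℕ → Fin N → Bool) × I

/-- The law of the outcome: the arrival indicators are independent over terminals and slots,
those of terminal `n` are Bernoulli with parameter `lam n`, and the seed is uniform on `[0, 1]`
and independent of the arrivals. -/
noncomputable def law {N : ℕ} (lam : Fin N → I) : Measure (Outcome N) :=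
  (Measure.infinitePi fun _ : ℕ =>
    Measure.pi fun n : Fin N => bernoulliMeasure true false (lam n)).prod (volume : Measure I)

/-- A scheduling and packet management policy. All decisions may depend on the whole outcome, in
particular on past, present and future arrivals at all terminals (non-causal policies). A packet is
named by the slot in which it was generated. -/
structure Policy (N : ℕ) where
  /-- the set of terminals scheduled in slot `t` -/
  sched : Outcome N → ℕ → Finset (Fin N)
  /-- the packet that terminal `n` transmits if it is scheduled in slot `t`; nothing is transmitted
  if this packet is not in the queue -/
  send : Outcome N → ℕ → Fin N → ℕ
  /-- the packets that terminal `n` discards at the end of slot `t` -/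
  drop : Outcome N → ℕ → Fin N → Finset ℕ
  measurableSet_sched : ∀ t n, MeasurableSet {ω | n ∈ sched ω t}
  measurableSet_send : ∀ t n s, MeasurableSet {ω | send ω t n = s}
  measurableSet_drop : ∀ t n s, MeasurableSet {ω | s ∈ drop ω t n}

/-- The state of the system between two slots. -/
structure State (N : ℕ) where
  /-- the packets stored at the terminals, named by the slots of their generation -/
  queue : Fin N → Finset ℕ
  /-- the age of information (AoI) of the terminals at the base station -/
  aoi : Fin N → ℕ

namespace Policy

variable {N : ℕ}

/-- In slot `t`, with state `x` before it, a packet of terminal `n` is delivered: `n` is the only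
scheduled terminal (otherwise there is a collision) and the packet to be sent is in its queue. -/
def Delivers (π : Policy N) (ω : Outcome N) (t : ℕ) (x : State N) (n : Fin N) : Prop :=
  π.sched ω t = {n} ∧ π.send ω t n ∈ x.queue n

instance (π : Policy N) (ω : Outcome N) (t : ℕ) (x : State N) (n : Fin N) :
    Decidable (π.Delivers ω t x n) :=
  inferInstanceAs (Decidable (_ ∧ _))

/-- The AoI reduction by an update of terminal `n` in slot `t`. A packet that arrived at the end of
slot `s` has age `t - (s + 1)` when it is transmitted in slot `t > s`; a delivered packet that is
older than the AoI does not change the AoI (truncated subtraction). -/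
def reduction (π : Policy N) (ω : Outcome N) (t : ℕ) (x : State N) (n : Fin N) : ℕ :=
  if π.Delivers ω t x n then x.aoi n - (t - (π.send ω t n + 1)) else 0

/-- One slot: scheduled transmission and AoI update, then packet arrivals, then discarding of
packets; every AoI increases by one. -/
def step (π : Policy N) (ω : Outcome N) (t : ℕ) (x : State N) : State N where
  queue n :=
    ((if π.Delivers ω t x n then (x.queue n).erase (π.send ω t n) else x.queue n) ∪
      (if ω.1 t n = true then {t} else ∅)) \ π.drop ω t n
  aoi n := x.aoi n - π.reduction ω t x n + 1

/-- The state before slot `t`, started with empty queues and AoI `h₀`. -/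
def state (π : Policy N) (h₀ : Fin N → ℕ) (ω : Outcome N) : ℕ → State N
  | 0 => ⟨fun _ => ∅, h₀⟩
  | t + 1 => π.step ω t (state π h₀ ω t)

/-- The `T`-horizon time-average AoI
`(1 / (T * N)) * ∑ (over the first T slots) ∑ (over n) (AoI of n at the end of the slot)`. -/
noncomputable def avgAoI (π : Policy N) (h₀ : Fin N → ℕ) (ω : Outcome N) (T : ℕ) : ℝ≥0∞ :=
  (∑ t ∈ Finset.range T, ∑ n, ((π.state h₀ ω (t + 1)).aoi n : ℝ≥0∞)) / (T * N)

/-- The infinite-horizon time-average AoI of a policy: the mean of `liminf_{T → ∞}` of the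
`T`-horizon averages. If these averages converge almost surely to a constant, it is that constant;
the `liminf` makes it meaningful, and as small as possible, for policies whose averages do not
converge. -/
noncomputable def timeAvgAoI (π : Policy N) (lam : Fin N → I) (h₀ : Fin N → ℕ) : ℝ≥0∞ :=
  ∫⁻ ω, liminf (fun T => π.avgAoI h₀ ω T) atTop ∂(law lam)

/-- The policy never stores more than `B` packets at a terminal. -/
def FitsBuffer (π : Policy N) (B : ℕ∞) : Prop :=
  ∀ h₀ ω t n, (((π.state h₀ ω t).queue n).card : ℕ∞) ≤ B

end Policy

/-- `n` is the smallest index at which `τ` is maximal. -/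
def IsMinArgmax {N : ℕ} (τ : Fin N → ℕ) (n : Fin N) : Prop :=
  (∀ m, τ m ≤ τ n) ∧ ∀ m, (∀ k, τ k ≤ τ m) → n ≤ m

instance {N : ℕ} (τ : Fin N → ℕ) (n : Fin N) : Decidable (IsMinArgmax τ n) :=
  inferInstanceAs (Decidable (_ ∧ _))

/-- Under round robin, the time at the beginning of slot `t` since terminal `n` was last scheduled;
the terminal with the largest value is scheduled (the smallest such index in case of ties). -/
def rrTau (N : ℕ) : ℕ → Fin N → ℕ
  | 0, _ => 0
  | t + 1, n => if IsMinArgmax (rrTau N t) n then 0 else rrTau N t n + 1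

/-- The slot of the last arrival at terminal `n` before slot `t` (`0` if there is none). -/
def lastArrival {N : ℕ} (ω : Outcome N) : ℕ → Fin N → ℕ
  | 0, _ => 0
  | t + 1, n => if ω.1 t n = true then t else lastArrival ω t n

theorem measurableSet_arrival {N : ℕ} (t : ℕ) (n : Fin N) :
    MeasurableSet {ω : Outcome N | ω.1 t n = true} := by
  have h : Measurable fun ω : Outcome N => ω.1 t n := by fun_prop
  exact h (measurableSet_singleton true)

theorem measurable_lastArrival {N : ℕ} (t : ℕ) (n : Fin N) :
    Measurable fun ω : Outcome N => lastArrival ω t n := by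
  induction t with
  | zero => exact measurable_const
  | succ t ih => exact Measurable.ite (measurableSet_arrival t n) measurable_const ih

/-- RR-ONE: round robin scheduling with one-packet buffers. A scheduled terminal transmits its last
arrival, and an arriving packet replaces every stored one. -/
def rrOne (N : ℕ) : Policy N where
  sched _ t := Finset.univ.filter fun n => IsMinArgmax (rrTau N t) n
  send ω t n := lastArrival ω t n
  drop ω t n := if ω.1 t n = true then Finset.range t else ∅
  measurableSet_sched _ _ := MeasurableSet.const _
  measurableSet_send t n s := measurable_lastArrival t n (measurableSet_singleton s)
  measurableSet_drop t n s := by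
    by_cases h : s < t
    · convert measurableSet_arrival t n using 3 with ω
      split_ifs with h' <;> simp [h, h']
    · convert MeasurableSet.empty using 1
      ext ω
      rw [Set.mem_ofPred_eq]
      split_ifs <;> simp_all

/-- The time-average AoI of RR-ONE. -/
noncomputable def hRR {N : ℕ} (lam : Fin N → I) (h₀ : Fin N → ℕ) : ℝ≥0∞ :=
  (rrOne N).timeAvgAoI lam h₀

/-- The minimum (infimum) time-average AoI over all policies with buffer size `B`. -/
noncomputable def hOpt {N : ℕ} (B : ℕ∞) (lam : Fin N → I) (h₀ : Fin N → ℕ) : ℝ≥0∞ :=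
  ⨅ π : {π : Policy N // π.FitsBuffer B}, π.1.timeAvgAoI lam h₀

end Uplink

open Uplink

/-! Everything reduces to one exact value and two bounds that hold on every sample path.

Exact value. From slot `N` on, the times since the last scheduling under round robin are a
permutation of `0, …, N - 1`. Once its first packet has been delivered, a terminal has AoI equal to
the time since it was last scheduled plus the age of its newest packet at that moment
(`aoi_rrOne_of_arrival`). That age is the time since the last success in a Bernoulli sequence, whose
time average is `1 / lam n` almost surely (`ae_tendsto_average_age`). Hence RR-ONE has average AoI
`(N - 1) / 2 + (∑ n, 1 / lam n) / N` (`hRR_eq`).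

Lower bounds. At most one packet is delivered per slot, so at most `k` terminals can have AoI at
most `k`, and the AoIs sum to at least `1 + … + N` (`sum_range_add_le_sum_aoi`). Also, no AoI can
fall below the age of the newest packet generated at its terminal (`le_aoi_add_lastArrival`), whence
the average is at least `(1 / lam i - 1) / N`. Both bounds are pathwise, so knowledge of the future,
randomization and larger buffers do not help. Squeezing between these bounds and the exact value
gives both limits.

The ages are dependent and are sampled at the scheduling times, so the strong law is proved by
second moments: the covariance of two ages decays geometrically in their distance. -/

section Age

/-! ### The time since the last success in independent trials, and its strong law. -/

variable {Ω : Type*}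

/-- The time since the last success before time `t` in the sequence of trials `X` (or since `0`, if
there is none). -/
def trialAge (X : ℕ → Ω → Bool) : ℕ → Ω → ℕ
  | 0, _ => 0
  | t + 1, ω => if X t ω = true then 1 else trialAge X t ω + 1

/-- The indicator of a failure at time `t`. -/
def failInd (X : ℕ → Ω → Bool) (t : ℕ) (ω : Ω) : ℝ := if X t ω = true then 0 else 1

/-- The trials before time `t`. -/
@[reducible] def trialPast (X : ℕ → Ω → Bool) (t : ℕ) : MeasurableSpace Ω :=
  ⨆ i ∈ Set.Iio t, MeasurableSpace.comap (X i) inferInstance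

theorem trialAge_succ_cast (X : ℕ → Ω → Bool) (t : ℕ) (ω : Ω) :
    (trialAge X (t + 1) ω : ℝ) = 1 + failInd X t ω * trialAge X t ω := by
  simp only [trialAge, failInd]
  split_ifs <;> push_cast <;> ring

theorem trialAge_le (X : ℕ → Ω → Bool) (t : ℕ) (ω : Ω) : trialAge X t ω ≤ t := by
  induction t with
  | zero => simp [trialAge]
  | succ t ih => simp only [trialAge]; split_ifs <;> omega

theorem measurable_trial_past (X : ℕ → Ω → Bool) {s t : ℕ} (h : s < t) :
    Measurable[trialPast X t] (X s) := by
  have h1 : MeasurableSpace.comap (X s) inferInstance ≤ trialPast X t :=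
    le_biSup (fun i => MeasurableSpace.comap (X i) inferInstance) (Set.mem_Iio.2 h)
  exact (comap_measurable (X s)).mono h1 le_rfl

theorem measurable_trialAge_past (X : ℕ → Ω → Bool) {s t : ℕ} (h : s ≤ t) :
    Measurable[trialPast X t] (fun ω => (trialAge X s ω : ℝ)) := by
  induction s with
  | zero => simpa only [trialAge] using measurable_const
  | succ s ih =>
    have h1 := ih (by omega)
    have h2 : MeasurableSet[trialPast X t] {ω | X s ω = true} :=
      measurable_trial_past X h (measurableSet_singleton true)
    simp only [trialAge_succ_cast, failInd]
    exact measurable_const.add ((Measurable.ite h2 measurable_const measurable_const).mul h1)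

variable {m : MeasurableSpace Ω} {μ : Measure Ω}

theorem trialPast_le {X : ℕ → Ω → Bool} (hX : ∀ t, Measurable (X t)) (t : ℕ) :
    trialPast X t ≤ m :=
  iSup₂_le fun i _ => (hX i).comap_le

theorem measurable_trialAge {X : ℕ → Ω → Bool} (hX : ∀ t, Measurable (X t)) (t : ℕ) :
    Measurable (fun ω => (trialAge X t ω : ℝ)) :=
  (measurable_trialAge_past X le_rfl).mono (trialPast_le hX t) le_rfl

theorem measurable_failInd {X : ℕ → Ω → Bool} (hX : ∀ t, Measurable (X t)) (t : ℕ) :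
    Measurable (failInd X t) :=
  Measurable.ite (hX t (measurableSet_singleton true)) measurable_const measurable_const

/-- Trial `t` is independent of the σ-algebra of the earlier trials. With `trialAge_succ_cast`, this
turns moments of the age into linear recursions. -/
theorem integral_past_mul_failInd {X : ℕ → Ω → Bool} (hX : ∀ t, Measurable (X t))
    (hi : iIndepFun X μ) (t : ℕ) {f : Ω → ℝ} (hf : Measurable[trialPast X t] f) :
    ∫ ω, f ω * failInd X t ω ∂μ = (∫ ω, f ω ∂μ) * ∫ ω, failInd X t ω ∂μ := by
  have h1 : Indep (trialPast X t) (⨆ i ∈ ({t} : Set ℕ), MeasurableSpace.comap (X i) inferInstance)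
      μ := indep_iSup_of_disjoint (fun i => (hX i).comap_le) hi (by simp)
  have h2 : Measurable[⨆ i ∈ ({t} : Set ℕ), MeasurableSpace.comap (X i) inferInstance]
      (failInd X t) := by
    have h3 : Measurable[⨆ i ∈ ({t} : Set ℕ), MeasurableSpace.comap (X i) inferInstance] (X t) := by
      have h4 : MeasurableSpace.comap (X t) inferInstance
          ≤ ⨆ i ∈ ({t} : Set ℕ), MeasurableSpace.comap (X i) inferInstance :=
        le_biSup (fun i => MeasurableSpace.comap (X i) inferInstance) (Set.mem_singleton t)
      exact (comap_measurable (X t)).mono h4 le_rfl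
    exact Measurable.ite (h3 (measurableSet_singleton true)) measurable_const measurable_const
  have h3 : IndepFun f (failInd X t) μ := by
    rw [IndepFun_iff_Indep]
    exact indep_of_indep_of_le_left (indep_of_indep_of_le_right h1 h2.comap_le) hf.comap_le
  exact h3.integral_fun_mul_eq_mul_integral
    (hf.mono (trialPast_le hX t) le_rfl).aestronglyMeasurable
    (measurable_failInd hX t).aestronglyMeasurable

theorem integrable_of_abs_le [IsFiniteMeasure μ] {f : Ω → ℝ} (hf : Measurable f) (C : ℝ)
    (h : ∀ ω, |f ω| ≤ C) : Integrable f μ :=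
  Integrable.of_bound hf.aestronglyMeasurable C (ae_of_all _ h)

/-- The deviation of the age from its stationary mean, if the failure probability is `q`. -/
noncomputable def ageDev (X : ℕ → Ω → Bool) (q : ℝ) (t : ℕ) (ω : Ω) : ℝ :=
  trialAge X t ω - (1 - q)⁻¹

theorem measurable_ageDev_past (X : ℕ → Ω → Bool) (q : ℝ) {s t : ℕ} (h : s ≤ t) :
    Measurable[trialPast X t] (ageDev X q s) :=
  (measurable_trialAge_past X h).sub measurable_const

theorem measurable_ageDev {X : ℕ → Ω → Bool} (hX : ∀ t, Measurable (X t)) (q : ℝ) (t : ℕ) :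
    Measurable (ageDev X q t) :=
  (measurable_trialAge hX t).sub measurable_const

theorem abs_ageDev_le (X : ℕ → Ω → Bool) (q : ℝ) (t : ℕ) (ω : Ω) :
    |ageDev X q t ω| ≤ t + |(1 - q)⁻¹| := by
  refine (abs_sub _ _).trans (add_le_add ?_ le_rfl)
  rw [abs_of_nonneg (by positivity)]
  exact_mod_cast trialAge_le X t ω

theorem integrable_ageDev_mul [IsFiniteMeasure μ] {X : ℕ → Ω → Bool} (hX : ∀ t, Measurable (X t))
    (q : ℝ) (s t : ℕ) : Integrable (fun ω => ageDev X q s ω * ageDev X q t ω) μ := by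
  refine integrable_of_abs_le ((measurable_ageDev hX q s).mul (measurable_ageDev hX q t))
    ((s + |(1 - q)⁻¹|) * (t + |(1 - q)⁻¹|)) fun ω => ?_
  rw [abs_mul]
  exact mul_le_mul (abs_ageDev_le X q s ω) (abs_ageDev_le X q t ω) (abs_nonneg _) (by positivity)

theorem integrable_trialAge_pow [IsFiniteMeasure μ] {X : ℕ → Ω → Bool}
    (hX : ∀ t, Measurable (X t)) (t k : ℕ) : Integrable (fun ω => (trialAge X t ω : ℝ) ^ k) μ := by
  refine integrable_of_abs_le ((measurable_trialAge hX t).pow_const k) ((t : ℝ) ^ k) fun ω => ?_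
  rw [abs_of_nonneg (by positivity)]
  exact pow_le_pow_left₀ (by positivity) (by exact_mod_cast trialAge_le X t ω) k

/-- A sequence whose second moments are summable converges to `0` almost surely. -/
theorem ae_tendsto_zero_of_integral_sq_le {f : ℕ → Ω → ℝ} (hf : ∀ k, Measurable (f k))
    (hf2 : ∀ k, Integrable (fun ω => f k ω ^ 2) μ) {b : ℕ → ℝ} (hb : Summable b)
    (h : ∀ k, ∫ ω, f k ω ^ 2 ∂μ ≤ b k) : ∀ᵐ ω ∂μ, Tendsto (fun k => f k ω) atTop (𝓝 0) := by
  have hb0 : ∀ k, 0 ≤ b k := fun k => (integral_nonneg fun ω => sq_nonneg _).trans (h k)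
  have h1 : ∫⁻ ω, ∑' k, ENNReal.ofReal (f k ω ^ 2) ∂μ ≠ ∞ := by
    rw [lintegral_tsum fun k => ((hf k).pow_const 2).ennreal_ofReal.aemeasurable]
    refine ne_top_of_le_ne_top hb.tsum_ofReal_ne_top (ENNReal.tsum_le_tsum fun k => ?_)
    rw [← ofReal_integral_eq_lintegral_ofReal (hf2 k) (ae_of_all _ fun ω => sq_nonneg _)]
    exact ENNReal.ofReal_le_ofReal (h k)
  have h2 := ae_lt_top
    (Measurable.tsum fun k => ((hf k).pow_const 2).ennreal_ofReal) h1
  filter_upwards [h2] with ω hω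
  have h3 := ENNReal.tendsto_atTop_zero_of_tsum_ne_top hω.ne
  have h4 := (ENNReal.tendsto_toReal ENNReal.zero_ne_top).comp h3
  have h5 : Tendsto (fun k => f k ω ^ 2) atTop (𝓝 0) := by
    refine h4.congr fun k => ?_
    simp [ENNReal.toReal_ofReal (sq_nonneg _)]
  have h6 := h5.sqrt
  simp only [Real.sqrt_sq_eq_abs, Real.sqrt_zero] at h6
  exact (tendsto_zero_iff_abs_tendsto_zero _).2 h6

variable [IsProbabilityMeasure μ] {X : ℕ → Ω → Bool} {q : ℝ}

/-- The mean satisfies `a (t + 1) = 1 + q * a t` with `a 0 = 0`, and the bound is the fixed point of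
this increasing recursion. -/
theorem integral_trialAge_le (hX : ∀ t, Measurable (X t)) (hi : iIndepFun X μ)
    (hq : ∀ t, ∫ ω, failInd X t ω ∂μ = q) (hq0 : 0 ≤ q) (hq1 : q < 1) (t : ℕ) :
    ∫ ω, (trialAge X t ω : ℝ) ∂μ ≤ (1 - q)⁻¹ := by
  have hpos : 0 < 1 - q := by linarith
  induction t with
  | zero => simp [trialAge, hpos.le]
  | succ t ih =>
    have hint : Integrable (fun ω => (trialAge X t ω : ℝ) * failInd X t ω) μ := by
      refine integrable_of_abs_le ((measurable_trialAge hX t).mul (measurable_failInd hX t)) t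
        fun ω => ?_
      have := trialAge_le X t ω
      simp only [failInd]
      split_ifs <;> simp [this]
    have h1 : ∫ ω, (trialAge X (t + 1) ω : ℝ) ∂μ = 1 + (∫ ω, (trialAge X t ω : ℝ) ∂μ) * q := by
      rw [← hq t, ← integral_past_mul_failInd hX hi t (measurable_trialAge_past X le_rfl)]
      simp_rw [trialAge_succ_cast, mul_comm (failInd X t _)]
      rw [integral_add (integrable_const _) hint]
      simp
    have h2 : 1 + (1 - q)⁻¹ * q = (1 - q)⁻¹ := by field_simp; ring
    rw [h1, ← h2]
    gcongr

/-- The constant is the fixed point of `x = 1 + q * (2 * (1 - q)⁻¹ + x)`, the recursion for the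
second moment with the mean replaced by its bound. -/
theorem integral_trialAge_sq_le (hX : ∀ t, Measurable (X t)) (hi : iIndepFun X μ)
    (hq : ∀ t, ∫ ω, failInd X t ω ∂μ = q) (hq0 : 0 ≤ q) (hq1 : q < 1) (t : ℕ) :
    ∫ ω, (trialAge X t ω : ℝ) ^ 2 ∂μ ≤ (1 + 2 * (1 - q)⁻¹ * q) * (1 - q)⁻¹ := by
  have hpos : 0 < 1 - q := by linarith
  induction t with
  | zero => simp [trialAge]; positivity
  | succ t ih =>
    set g : Ω → ℝ := fun ω => 2 * (trialAge X t ω : ℝ) + (trialAge X t ω : ℝ) ^ 2 with hg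
    have hgm : Measurable[trialPast X t] g :=
      ((measurable_trialAge_past X le_rfl).const_mul 2).add
        ((measurable_trialAge_past X le_rfl).pow_const 2)
    have hint : Integrable (fun ω => g ω * failInd X t ω) μ := by
      refine integrable_of_abs_le ((hgm.mono (trialPast_le hX t) le_rfl).mul
        (measurable_failInd hX t)) (2 * t + (t : ℝ) ^ 2) fun ω => ?_
      have h1 : (trialAge X t ω : ℝ) ≤ t := by exact_mod_cast trialAge_le X t ω
      have h2 : g ω ≤ 2 * t + (t : ℝ) ^ 2 := by
        simp only [hg]
        gcongr
      have h3 : 0 ≤ g ω := by simp only [hg]; positivity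
      simp only [failInd]
      split_ifs
      · simp; positivity
      · simpa [abs_of_nonneg h3] using h2
    -- The failure indicator equals its own square, so the square of the recursion is again linear
    -- in it.
    have h0 : ∀ ω, (trialAge X (t + 1) ω : ℝ) ^ 2 = 1 + g ω * failInd X t ω := by
      intro ω
      simp only [trialAge_succ_cast, failInd, hg]
      split_ifs <;> ring
    have i1 : Integrable (fun ω => (trialAge X t ω : ℝ)) μ := by
      simpa using integrable_trialAge_pow (μ := μ) hX t 1
    have h1 : ∫ ω, (trialAge X (t + 1) ω : ℝ) ^ 2 ∂μ
        = 1 + (2 * (∫ ω, (trialAge X t ω : ℝ) ∂μ) + ∫ ω, (trialAge X t ω : ℝ) ^ 2 ∂μ) * q := by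
      simp_rw [h0]
      rw [integral_add (integrable_const _) hint, integral_past_mul_failInd hX hi t hgm, hq t, hg,
        integral_add (i1.const_mul 2) (integrable_trialAge_pow hX t 2), integral_const_mul]
      simp
    have h2 := integral_trialAge_le hX hi hq hq0 hq1 t
    have h3 : 1 + (2 * (1 - q)⁻¹ + (1 + 2 * (1 - q)⁻¹ * q) * (1 - q)⁻¹) * q
        = (1 + 2 * (1 - q)⁻¹ * q) * (1 - q)⁻¹ := by field_simp; ring
    rw [h1, ← h3]
    gcongr

theorem exists_integral_ageDev_sq_le (hX : ∀ t, Measurable (X t)) (hi : iIndepFun X μ)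
    (hq : ∀ t, ∫ ω, failInd X t ω ∂μ = q) (hq0 : 0 ≤ q) (hq1 : q < 1) :
    ∃ C : ℝ, 0 ≤ C ∧ ∀ t, ∫ ω, ageDev X q t ω * ageDev X q t ω ∂μ ≤ C := by
  have hpos : 0 < 1 - q := by linarith
  refine ⟨(1 + 2 * (1 - q)⁻¹ * q) * (1 - q)⁻¹ + ((1 - q)⁻¹) ^ 2, by positivity, fun t => ?_⟩
  have h1 : ∫ ω, ageDev X q t ω * ageDev X q t ω ∂μ
      ≤ ∫ ω, ((trialAge X t ω : ℝ) ^ 2 + ((1 - q)⁻¹) ^ 2) ∂μ := by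
    refine integral_mono (integrable_ageDev_mul hX q t t)
      ((integrable_trialAge_pow hX t 2).add (integrable_const _)) fun ω => ?_
    have : 0 ≤ (trialAge X t ω : ℝ) * (1 - q)⁻¹ := by positivity
    simp only [ageDev]
    nlinarith
  rw [integral_add (integrable_trialAge_pow hX t 2) (integrable_const _)] at h1
  have h2 := integral_trialAge_sq_le hX hi hq hq0 hq1 t
  simp only [integral_const, probReal_univ, one_smul] at h1
  linarith

/-- Given the past, the next deviation has mean `q` times the current one, because `(1 - q)⁻¹` is
fixed by `x ↦ 1 + q * x`. The process starts at `0` and is not stationary, so the deviations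
themselves need not have mean zero. -/
theorem integral_ageDev_mul_add (hX : ∀ t, Measurable (X t)) (hi : iIndepFun X μ)
    (hq : ∀ t, ∫ ω, failInd X t ω ∂μ = q) (hq1 : q < 1) (s k : ℕ) :
    ∫ ω, ageDev X q s ω * ageDev X q (s + k) ω ∂μ
      = q ^ k * ∫ ω, ageDev X q s ω * ageDev X q s ω ∂μ := by
  have hpos : 1 - q ≠ 0 := by linarith
  induction k with
  | zero => simp
  | succ k ih =>
    have m1 : Measurable[trialPast X (s + k)]
        (fun ω => ageDev X q s ω * (trialAge X (s + k) ω : ℝ)) :=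
      (measurable_ageDev_past X q (by omega)).mul (measurable_trialAge_past X le_rfl)
    have hd : Integrable (ageDev X q s) μ :=
      integrable_of_abs_le (measurable_ageDev hX q s) _ (abs_ageDev_le X q s)
    have hda : Integrable (fun ω => ageDev X q s ω * (trialAge X (s + k) ω : ℝ)) μ := by
      have := (integrable_ageDev_mul (μ := μ) hX q s (s + k)).add (hd.mul_const (1 - q)⁻¹)
      refine this.congr (ae_of_all _ fun ω => ?_)
      simp only [Pi.add_apply, ageDev]
      ring
    have h1 : ∀ ω, ageDev X q s ω * ageDev X q (s + (k + 1)) ω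
        = ageDev X q s ω * (1 - (1 - q)⁻¹)
          + ageDev X q s ω * (trialAge X (s + k) ω : ℝ) * failInd X (s + k) ω := by
      intro ω
      have : ageDev X q (s + (k + 1)) ω
          = 1 + failInd X (s + k) ω * trialAge X (s + k) ω - (1 - q)⁻¹ := by
        rw [← trialAge_succ_cast]; rfl
      rw [this]
      ring
    have hint : Integrable
        (fun ω => ageDev X q s ω * (trialAge X (s + k) ω : ℝ) * failInd X (s + k) ω) μ := by
      refine (hda.mul_bdd (c := 1) (measurable_failInd hX (s + k)).aestronglyMeasurable
        (ae_of_all _ fun ω => ?_))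
      simp only [failInd]
      split_ifs <;> simp
    have h2 : ∀ ω, ageDev X q s ω * (trialAge X (s + k) ω : ℝ)
        = ageDev X q s ω * ageDev X q (s + k) ω + ageDev X q s ω * (1 - q)⁻¹ := by
      intro ω
      simp only [ageDev]
      ring
    have h3 : ∫ ω, ageDev X q s ω * (trialAge X (s + k) ω : ℝ) ∂μ
        = q ^ k * (∫ ω, ageDev X q s ω * ageDev X q s ω ∂μ)
          + (∫ ω, ageDev X q s ω ∂μ) * (1 - q)⁻¹ := by
      simp_rw [h2]
      rw [integral_add (integrable_ageDev_mul hX q s (s + k)) (hd.mul_const _), ih,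
        integral_mul_const]
    simp_rw [h1]
    rw [integral_add (hd.mul_const _) hint, integral_mul_const,
      integral_past_mul_failInd hX hi _ m1, hq, h3]
    -- The terms containing `∫ ageDev X q s` cancel, since `1 - (1 - q)⁻¹ + q * (1 - q)⁻¹ = 0`.
    field_simp
    ring

/-- The autocovariance of the age decays exponentially, so that the sum over times that spread out
at least linearly has a second moment of linear order. -/
theorem exists_integral_sum_ageDev_sq_le (hX : ∀ t, Measurable (X t)) (hi : iIndepFun X μ)
    (hq : ∀ t, ∫ ω, failInd X t ω ∂μ = q) (hq0 : 0 ≤ q) (hq1 : q < 1) (τ : ℕ → ℕ) (D : ℕ)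
    (hτ : ∀ s t, s ≤ t → t + τ s ≤ τ t + s + D) :
    ∃ K : ℝ, ∀ T : ℕ, ∫ ω, (∑ t ∈ Finset.range T, ageDev X q (τ t) ω) ^ 2 ∂μ ≤ K * T := by
  obtain ⟨C, hC0, hC⟩ := exists_integral_ageDev_sq_le hX hi hq hq0 hq1
  -- By `hτ`, the sampling times are at least `t - s - D` apart. If `τ` reverses the order of `s`
  -- and `t`, then `t - s ≤ D` and the truncated exponent is `0`.
  have hcov : ∀ s t, s ≤ t → ∫ ω, ageDev X q (τ s) ω * ageDev X q (τ t) ω ∂μ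
      ≤ C * q ^ (t - s - D) := by
    have key : ∀ a k d, d ≤ k → ∫ ω, ageDev X q a ω * ageDev X q (a + k) ω ∂μ ≤ C * q ^ d := by
      intro a k d hd
      rw [integral_ageDev_mul_add hX hi hq hq1, mul_comm]
      exact mul_le_mul (hC a) (pow_le_pow_of_le_one hq0 hq1.le hd) (by positivity) hC0
    intro s t hst
    have h := hτ s t hst
    rcases le_total (τ s) (τ t) with h' | h'
    · obtain ⟨k, hk⟩ := Nat.exists_eq_add_of_le h'
      rw [hk]
      exact key _ _ _ (by omega)
    · obtain ⟨k, hk⟩ := Nat.exists_eq_add_of_le h'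
      rw [hk]
      simp_rw [mul_comm (ageDev X q (τ t + k) _)]
      exact key _ _ _ (by omega)
  have hsum : Summable fun j : ℕ => q ^ (j + 1 - D) := by
    rw [← summable_nat_add_iff D]
    refine (((summable_geometric_of_lt_one hq0 hq1).mul_left q)).congr fun j => ?_
    rw [show j + D + 1 - D = j + 1 by omega, pow_succ']
  -- This constant bounds the growth of the second moment from `T` to `T + 1`: twice the covariances
  -- with the new term, plus its own second moment.
  refine ⟨2 * (C * ∑' j : ℕ, q ^ (j + 1 - D)) + C, fun T => ?_⟩
  have hS : ∀ T, Integrable (fun ω => (∑ t ∈ Finset.range T, ageDev X q (τ t) ω) ^ 2) μ := by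
    intro T
    simp_rw [pow_two, Finset.sum_mul_sum]
    exact integrable_finsetSum _ fun s _ => integrable_finsetSum _ fun t _ =>
      integrable_ageDev_mul hX q _ _
  induction T with
  | zero => simp
  | succ T ih =>
    have hSZ : Integrable (fun ω => ∑ t ∈ Finset.range T,
        ageDev X q (τ t) ω * ageDev X q (τ T) ω) μ :=
      integrable_finsetSum _ fun t _ => integrable_ageDev_mul hX q _ _
    have h1 : ∀ ω, (∑ t ∈ Finset.range (T + 1), ageDev X q (τ t) ω) ^ 2
        = (∑ t ∈ Finset.range T, ageDev X q (τ t) ω) ^ 2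
          + 2 * (∑ t ∈ Finset.range T, ageDev X q (τ t) ω * ageDev X q (τ T) ω)
          + ageDev X q (τ T) ω * ageDev X q (τ T) ω := by
      intro ω
      rw [Finset.sum_range_succ, ← Finset.sum_mul]
      ring
    have h12 : Integrable (fun ω => (∑ t ∈ Finset.range T, ageDev X q (τ t) ω) ^ 2
        + 2 * ∑ t ∈ Finset.range T, ageDev X q (τ t) ω * ageDev X q (τ T) ω) μ :=
      (hS T).add (hSZ.const_mul 2)
    simp_rw [h1]
    rw [integral_add h12 (integrable_ageDev_mul hX q _ _),
      integral_add (hS T) (hSZ.const_mul 2), integral_const_mul,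
      integral_finsetSum _ fun t _ => integrable_ageDev_mul hX q _ _]
    have h2 : ∑ t ∈ Finset.range T, ∫ ω, ageDev X q (τ t) ω * ageDev X q (τ T) ω ∂μ
        ≤ C * ∑' j : ℕ, q ^ (j + 1 - D) := by
      calc _ ≤ ∑ t ∈ Finset.range T, C * q ^ (T - t - D) :=
            Finset.sum_le_sum fun t ht => hcov t T (Finset.mem_range.1 ht).le
        _ = C * ∑ j ∈ Finset.range T, q ^ (j + 1 - D) := by
            rw [Finset.mul_sum, ← Finset.sum_range_reflect]
            refine Finset.sum_congr rfl fun j hj => ?_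
            have := Finset.mem_range.1 hj
            rw [show T - (T - 1 - j) = j + 1 by omega]
        _ ≤ _ := by
            gcongr
            exact hsum.sum_le_tsum _ fun j _ => by positivity
    have h3 := hC (τ T)
    push_cast
    linarith

/-- Strong law of large numbers for the time since the last success. -/
theorem ae_tendsto_average_trialAge (hX : ∀ t, Measurable (X t)) (hi : iIndepFun X μ)
    (hq : ∀ t, ∫ ω, failInd X t ω ∂μ = q) (hq0 : 0 ≤ q) (hq1 : q < 1) (τ : ℕ → ℕ) (D : ℕ)
    (hτ : ∀ s t, s ≤ t → t + τ s ≤ τ t + s + D) :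
    ∀ᵐ ω ∂μ, Tendsto (fun T : ℕ => (∑ t ∈ Finset.range T, (trialAge X (τ t) ω : ℝ)) / T) atTop
      (𝓝 (1 - q)⁻¹) := by
  obtain ⟨K, hK⟩ := exists_integral_sum_ageDev_sq_le hX hi hq hq0 hq1 τ D hτ
  -- Along the squares, the averaged deviation has second moment at most `K / (k + 1) ^ 2`, which is
  -- summable.
  set c : ℕ → ℕ := fun k => (k + 1) ^ 2 with hc
  have hS : ∀ T, Measurable fun ω => ∑ t ∈ Finset.range T, ageDev X q (τ t) ω := fun T =>
    Finset.measurable_fun_sum _ fun t _ => measurable_ageDev hX q _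
  have hS2 : ∀ T, Integrable (fun ω => (∑ t ∈ Finset.range T, ageDev X q (τ t) ω) ^ 2) μ := by
    intro T
    simp_rw [pow_two, Finset.sum_mul_sum]
    exact integrable_finsetSum _ fun s _ => integrable_finsetSum _ fun t _ =>
      integrable_ageDev_mul hX q _ _
  have hsum : Summable fun k : ℕ => K * (1 / ((k + 1 : ℕ) : ℝ) ^ 2) :=
    ((summable_nat_add_iff 1).2 (Real.summable_one_div_nat_pow.2 one_lt_two)).mul_left K
  have key := ae_tendsto_zero_of_integral_sq_le (μ := μ)
    (f := fun k ω => (∑ t ∈ Finset.range (c k), ageDev X q (τ t) ω) / c k)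
    (fun k => (hS (c k)).div_const _)
    (fun k => by simp_rw [div_pow]; exact (hS2 (c k)).div_const _) hsum
    (fun k => by
      simp_rw [div_pow]
      rw [integral_div, div_le_iff₀ (by positivity)]
      refine (hK (c k)).trans (le_of_eq ?_)
      simp only [hc]
      push_cast
      field_simp)
  filter_upwards [key] with ω hω
  -- Ages are nonnegative, so their partial sums are monotone; as consecutive squares have ratio
  -- tending to `1`, convergence along the squares extends to all `T`.
  refine tendsto_div_of_monotone_of_exists_subseq_tendsto_div
    (fun T => ∑ t ∈ Finset.range T, (trialAge X (τ t) ω : ℝ)) _ ?_ fun a ha =>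
      ⟨c, ?_, ?_, ?_⟩
  · exact monotone_nat_of_le_succ fun T => by
      rw [Finset.sum_range_succ]
      exact le_add_of_nonneg_right (by positivity)
  · have h1 : Tendsto (fun k : ℕ => (1 + 1 / ((k : ℝ) + 1)) ^ 2) atTop (𝓝 1) := by
      have := (tendsto_one_div_add_atTop_nhds_zero_nat (𝕜 := ℝ)).const_add 1
      simpa using this.pow 2
    filter_upwards [h1.eventually (gt_mem_nhds ha)] with k hk
    have h2 : (c (k + 1) : ℝ) = (1 + 1 / ((k : ℝ) + 1)) ^ 2 * c k := by
      simp only [hc]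
      push_cast
      field_simp
    rw [h2]
    gcongr
  · exact tendsto_atTop_mono (fun k => by simp only [hc, id]; nlinarith) tendsto_id
  · have h1 := hω.add_const (1 - q)⁻¹
    rw [zero_add] at h1
    refine h1.congr fun k => ?_
    have : (c k : ℝ) ≠ 0 := by simp only [hc]; positivity
    simp only [ageDev, Finset.sum_sub_distrib, Finset.sum_const, Finset.card_range, nsmul_eq_mul]
    field_simp
    ring

end Age

namespace Uplink

variable {N : ℕ}

/-! ### The arrival process and the ages of the last arrivals. -/

theorem lastArrival_le (ω : Outcome N) (t : ℕ) (n : Fin N) : lastArrival ω t n ≤ t := by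
  induction t with
  | zero => simp [lastArrival]
  | succ t ih => simp only [lastArrival]; split_ifs <;> omega

theorem lastArrival_le_succ (ω : Outcome N) (t : ℕ) (n : Fin N) :
    lastArrival ω t n ≤ lastArrival ω (t + 1) n := by
  have := lastArrival_le ω t n
  simp only [lastArrival]
  split_ifs <;> omega

/-- The two default values agree: before the first arrival the age is `t` and the arrival slot is
`0`. -/
theorem trialAge_add_lastArrival (ω : Outcome N) (t : ℕ) (n : Fin N) :
    trialAge (fun s (ω : Outcome N) => ω.1 s n) t ω + lastArrival ω t n = t := by
  induction t with
  | zero => simp [trialAge, lastArrival]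
  | succ t ih =>
    simp only [trialAge, lastArrival]
    split_ifs <;> omega

theorem trialAge_eq (ω : Outcome N) (t : ℕ) (n : Fin N) :
    trialAge (fun s (ω : Outcome N) => ω.1 s n) t ω = t - lastArrival ω t n :=
  Nat.eq_sub_of_add_eq (trialAge_add_lastArrival ω t n)

instance isProbabilityMeasure_law (lam : Fin N → I) : IsProbabilityMeasure (law lam) := by
  unfold law
  infer_instance

theorem measurePreserving_fst_law (lam : Fin N → I) :
    MeasurePreserving Prod.fst (law lam) (Measure.infinitePi fun _ : ℕ =>
      Measure.pi fun n : Fin N => bernoulliMeasure true false (lam n)) := by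
  unfold law
  exact measurePreserving_fst

theorem measurePreserving_arrival (lam : Fin N → I) (t : ℕ) (n : Fin N) :
    MeasurePreserving (fun ω : Outcome N => ω.1 t n) (law lam)
      (bernoulliMeasure true false (lam n)) :=
  (measurePreserving_eval (fun n : Fin N => bernoulliMeasure true false (lam n)) n).comp
    ((measurePreserving_eval_infinitePi (fun _ : ℕ =>
      Measure.pi fun n : Fin N => bernoulliMeasure true false (lam n)) t).comp
        (measurePreserving_fst_law lam))

theorem measurable_arrival (t : ℕ) (n : Fin N) : Measurable fun ω : Outcome N => ω.1 t n := by
  fun_prop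

theorem iIndepFun_arrival (lam : Fin N → I) (n : Fin N) :
    iIndepFun (fun (t : ℕ) (ω : Outcome N) => ω.1 t n) (law lam) := by
  rw [iIndepFun_iff_map_fun_eq_infinitePi_map (fun t => measurable_arrival t n)]
  have h1 := (iIndepFun_iff_map_fun_eq_infinitePi_map (P := Measure.infinitePi fun _ : ℕ =>
      Measure.pi fun n : Fin N => bernoulliMeasure true false (lam n))
      (X := fun (t : ℕ) (x : ℕ → Fin N → Bool) => x t n) (fun t => by fun_prop)).1
    (iIndepFun_infinitePi (P := fun _ : ℕ =>
      Measure.pi fun n : Fin N => bernoulliMeasure true false (lam n))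
      (X := fun _ x => x n) fun _ => by fun_prop)
  rw [← (measurePreserving_fst_law lam).map_eq, Measure.map_map (by fun_prop) (by fun_prop)] at h1
  refine h1.trans ?_
  congr 1
  funext t
  rw [Measure.map_map (by fun_prop) (by fun_prop)]
  rfl

theorem integral_failInd_arrival (lam : Fin N → I) (t : ℕ) (n : Fin N) :
    ∫ ω, failInd (fun s (ω : Outcome N) => ω.1 s n) t ω ∂(law lam) = 1 - lam n := by
  have h1 : ∀ ω : Outcome N, failInd (fun s (ω : Outcome N) => ω.1 s n) t ω
      = ((fun ω : Outcome N => ω.1 t n) ⁻¹' {false}).indicator 1 ω := by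
    intro ω
    simp only [failInd, Set.indicator, Set.mem_preimage, Set.mem_singleton_iff, Pi.one_apply]
    rcases Bool.eq_false_or_eq_true (ω.1 t n) with h | h <;> simp [h]
  simp_rw [h1]
  rw [integral_indicator_one (measurable_arrival t n (measurableSet_singleton false)), Measure.real,
    (measurePreserving_arrival lam t n).measure_preimage (measurableSet_singleton _).nullMeasurableSet]
  simp

/-- The age of the last arrival at terminal `n` has time average `1 / lam n`, even if it is sampled
at times `τ t` that are not `t`. -/
theorem ae_tendsto_average_age (lam : Fin N → I) (n : Fin N) (hn : 0 < lam n) (τ : ℕ → ℕ) (D : ℕ)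
    (hτ : ∀ s t, s ≤ t → t + τ s ≤ τ t + s + D) :
    ∀ᵐ ω ∂(law lam), Tendsto (fun T : ℕ =>
      (∑ t ∈ Finset.range T, ((τ t - lastArrival ω (τ t) n : ℕ) : ℝ)) / T) atTop
      (𝓝 (1 / (lam n : ℝ))) := by
  have h1 : (0 : ℝ) < lam n := hn
  have h := ae_tendsto_average_trialAge (fun t => measurable_arrival t n)
    (iIndepFun_arrival lam n) (fun t => integral_failInd_arrival lam t n)
    (sub_nonneg.2 (lam n).2.2) (by linarith) τ D hτ
  simp only [sub_sub_cancel, trialAge_eq] at h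
  simpa only [one_div] using h

/-! ### The round robin schedule. -/

theorem IsMinArgmax.unique {τ : Fin N → ℕ} {m n : Fin N} (hm : IsMinArgmax τ m)
    (hn : IsMinArgmax τ n) : m = n :=
  le_antisymm (hm.2 n hn.1) (hn.2 m hm.1)

/-- During the first `N` slots the terminals not yet scheduled are tied at the maximum, and the tie
rule picks terminal `t` in slot `t`. -/
theorem rrTau_of_le {t : ℕ} (ht : t ≤ N) (n : Fin N) :
    rrTau N t n = if (n : ℕ) < t then t - 1 - n else t := by
  induction t generalizing n with
  | zero => simp [rrTau]
  | succ t ih =>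
    have ih := ih (by omega)
    have h1 : IsMinArgmax (rrTau N t) n ↔ (n : ℕ) = t := by
      have hlt : ∀ m : Fin N, rrTau N t m ≤ t := fun m => by rw [ih]; split_ifs <;> omega
      have heq : rrTau N t ⟨t, ht⟩ = t := by rw [ih]; simp
      constructor
      · intro h
        have h2 := h.1 ⟨t, ht⟩
        have h3 := h.2 ⟨t, ht⟩ fun k => by rw [heq]; exact hlt k
        rw [heq, ih] at h2
        have h4 : (n : ℕ) ≤ t := h3
        split_ifs at h2 <;> omega
      · intro h
        obtain rfl : n = ⟨t, ht⟩ := Fin.ext h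
        refine ⟨fun m => by rw [heq]; exact hlt m, fun m hm => ?_⟩
        have h2 := hm ⟨t, ht⟩
        rw [heq, ih] at h2
        change t ≤ (m : ℕ)
        split_ifs at h2 <;> omega
    simp only [rrTau, h1, ih]
    split_ifs <;> omega

/-- The values form a permutation of `0, …, N - 1`. A slot preserves this: the value `N - 1` is
reset to `0` and all others move up by one. -/
theorem rrTau_lt_and_injective {t : ℕ} (ht : N ≤ t) :
    (∀ n, rrTau N t n < N) ∧ Function.Injective (rrTau N t) := by
  induction t, ht using Nat.le_induction with
  | base =>
    have h : ∀ n, rrTau N N n = N - 1 - n := fun n => by rw [rrTau_of_le le_rfl, if_pos n.2]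
    refine ⟨fun n => by have := n.2; rw [h]; omega, fun m n hmn => Fin.ext ?_⟩
    have := m.2
    have := n.2
    rw [h, h] at hmn
    omega
  | succ t ht ih =>
    obtain ⟨hlt, hinj⟩ := ih
    have hbij : Function.Bijective (fun n => (⟨rrTau N t n, hlt n⟩ : Fin N)) :=
      Finite.injective_iff_bijective.1 fun m n h => hinj (by simpa using h)
    have harg : ∀ n, rrTau N t n = N - 1 → IsMinArgmax (rrTau N t) n := by
      intro n hn
      refine ⟨fun m => by have := hlt m; omega, fun m hm => ?_⟩
      have h1 := hm n
      have h2 := hlt m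
      exact (hinj (by omega)).le
    constructor
    · intro n
      have h1 := hlt n
      simp only [rrTau]
      split_ifs with h
      · omega
      · have := mt (harg n) h
        omega
    · intro m n hmn
      simp only [rrTau] at hmn
      split_ifs at hmn with h1 h2 h2
      · exact h1.unique h2
      · exact hinj (by omega)

theorem sum_rrTau {t : ℕ} (ht : N ≤ t) : ∑ n, rrTau N t n = ∑ k ∈ Finset.range N, k := by
  obtain ⟨hlt, hinj⟩ := rrTau_lt_and_injective ht
  have hbij : Function.Bijective (fun n => (⟨rrTau N t n, hlt n⟩ : Fin N)) :=
    Finite.injective_iff_bijective.1 fun m n h => hinj (by simpa using h)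
  rw [Finset.sum_range]
  exact hbij.sum_comp (fun k : Fin N => (k : ℕ))

theorem rrTau_le (t : ℕ) (n : Fin N) : rrTau N t n ≤ N := by
  rcases le_total t N with h | h
  · rw [rrTau_of_le h]
    split_ifs <;> omega
  · exact ((rrTau_lt_and_injective h).1 n).le

/-! ### Queues and AoI under RR-ONE. -/

/-- The last arrival at terminal `n` before the slot in which round robin last scheduled it. -/
def lastSampled (ω : Outcome N) : ℕ → Fin N → ℕ
  | 0, _ => 0
  | t + 1, n => if IsMinArgmax (rrTau N t) n then lastArrival ω t n else lastSampled ω t n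

/-- The last scheduling took place in slot `t - rrTau N (t + 1) n`. If there was none, truncated
subtraction gives `0`, where `lastArrival` has the default value of `lastSampled`. -/
theorem lastSampled_succ_eq (ω : Outcome N) (t : ℕ) (n : Fin N) :
    lastSampled ω (t + 1) n = lastArrival ω (t - rrTau N (t + 1) n) n := by
  induction t with
  | zero => simp only [lastSampled, Nat.zero_sub, lastArrival]; split_ifs <;> rfl
  | succ t ih =>
    rw [lastSampled]
    conv_rhs => rw [rrTau]
    split_ifs with h
    · simp
    · rw [ih, Nat.add_sub_add_right]

theorem rrOne_delivers_iff (ω : Outcome N) (t : ℕ) (x : State N) (n : Fin N) :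
    (rrOne N).Delivers ω t x n ↔
      IsMinArgmax (rrTau N t) n ∧ lastArrival ω t n ∈ x.queue n := by
  refine and_congr_left fun _ => ⟨fun h => ?_, fun h => ?_⟩
  · have h1 : n ∈ (rrOne N).sched ω t := by rw [h]; exact Finset.mem_singleton_self n
    simpa [rrOne] using h1
  · ext m
    simp only [rrOne, Finset.mem_filter, Finset.mem_univ, true_and, Finset.mem_singleton]
    exact ⟨fun hm => hm.unique h, fun hm => hm ▸ h⟩

/-- An arrival in slot `t` discards exactly the packets named by smaller slots, so it survives
alone. The last two conclusions exclude the default value `0` of `lastArrival`. -/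
theorem mem_queue_rrOne (h₀ : Fin N → ℕ) (ω : Outcome N) (t : ℕ) (n : Fin N) {s : ℕ}
    (hs : s ∈ ((rrOne N).state h₀ ω t).queue n) :
    s = lastArrival ω t n ∧ s < t ∧ ω.1 s n = true := by
  induction t with
  | zero => simp [Policy.state] at hs
  | succ t ih =>
    simp only [Policy.state, Policy.step, Finset.mem_sdiff, Finset.mem_union] at hs
    obtain ⟨h1, h2⟩ := hs
    have hd : (rrOne N).drop ω t n = if ω.1 t n = true then Finset.range t else ∅ := rfl
    have h3 : s ∈ ((rrOne N).state h₀ ω t).queue n ∨ s ∈ (if ω.1 t n = true then {t} else ∅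
        : Finset ℕ) := by
      refine h1.imp_left fun h => ?_
      split_ifs at h
      · exact Finset.mem_of_mem_erase h
      · exact h
    simp only [lastArrival]
    by_cases ha : ω.1 t n = true
    · simp only [hd, ha, if_true, Finset.mem_range, Finset.mem_singleton] at h2 h3 ⊢
      rcases h3 with h3 | rfl
      · exact absurd (ih h3).2.1 h2
      · exact ⟨rfl, by omega, ha⟩
    · simp only [ha, Bool.false_eq_true, if_false, Finset.notMem_empty, or_false] at h3 ⊢
      obtain ⟨h4, h5, h6⟩ := ih h3
      exact ⟨h4, by omega, h6⟩

theorem rrOne_fitsBuffer {B : ℕ∞} (hB : 1 ≤ B) : (rrOne N).FitsBuffer B := by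
  intro h₀ ω t n
  refine le_trans ?_ hB
  have : (((rrOne N).state h₀ ω t).queue n).card ≤ 1 :=
    Finset.card_le_one.2 fun a ha b hb => by
      rw [(mem_queue_rrOne h₀ ω t n ha).1, (mem_queue_rrOne h₀ ω t n hb).1]
  exact_mod_cast this

theorem lastArrival_mem_queue_rrOne_succ (h₀ : Fin N → ℕ) (ω : Outcome N) (t : ℕ) (n : Fin N)
    (h : ω.1 t n = true ∨ (lastArrival ω t n ∈ ((rrOne N).state h₀ ω t).queue n ∧
      ¬ IsMinArgmax (rrTau N t) n)) :
    lastArrival ω (t + 1) n ∈ ((rrOne N).state h₀ ω (t + 1)).queue n := by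
  have hd : (rrOne N).drop ω t n = if ω.1 t n = true then Finset.range t else ∅ := rfl
  simp only [Policy.state, Policy.step, Finset.mem_sdiff, Finset.mem_union, lastArrival, hd]
  by_cases ha : ω.1 t n = true
  · simp [ha]
  · obtain ⟨h1, h2⟩ := h.resolve_left ha
    simp [ha, rrOne_delivers_iff, h1, h2]

theorem aoi_rrOne_succ (h₀ : Fin N → ℕ) (ω : Outcome N) (t : ℕ) (n : Fin N) :
    ((rrOne N).state h₀ ω (t + 1)).aoi n =
      (if IsMinArgmax (rrTau N t) n ∧ lastArrival ω t n ∈ ((rrOne N).state h₀ ω t).queue n then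
        min (((rrOne N).state h₀ ω t).aoi n) (t - (lastArrival ω t n + 1))
      else ((rrOne N).state h₀ ω t).aoi n) + 1 := by
  have hs : (rrOne N).send ω t n = lastArrival ω t n := rfl
  simp only [Policy.state, Policy.step, Policy.reduction, rrOne_delivers_iff, hs]
  split_ifs <;> omega

/-- Under RR-ONE, either no arrival at `n` has been sampled yet, or the AoI of `n` is given by the
last sampled arrival. -/
theorem rrOne_invariant (h₀ : Fin N → ℕ) (ω : Outcome N) (t : ℕ) (n : Fin N) :
    (((rrOne N).state h₀ ω t).aoi n = h₀ n + t ∧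
      (∀ s < t, ω.1 s n = true → lastArrival ω t n ∈ ((rrOne N).state h₀ ω t).queue n) ∧
      (∀ s, s + rrTau N t n + 1 < t → ω.1 s n = false)) ∨
    (((rrOne N).state h₀ ω t).aoi n + lastSampled ω t n + 1 = t ∧
      lastSampled ω t n ≤ lastArrival ω t n ∧
      (lastSampled ω t n ≠ lastArrival ω t n →
        lastArrival ω t n ∈ ((rrOne N).state h₀ ω t).queue n)) := by
  induction t with
  | zero => left; simp [Policy.state]
  | succ t ih =>
    have hLs := lastArrival_le_succ ω t n
    have hLn : ω.1 t n ≠ true → lastArrival ω (t + 1) n = lastArrival ω t n := fun h => by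
      simp [lastArrival, h]
    have hsucc := lastArrival_mem_queue_rrOne_succ h₀ ω t n
    rw [aoi_rrOne_succ]
    have hmem : lastArrival ω t n ∈ ((rrOne N).state h₀ ω t).queue n → lastArrival ω t n < t :=
      fun h => (mem_queue_rrOne h₀ ω t n h).2.1
    by_cases hm : IsMinArgmax (rrTau N t) n
    · by_cases hq : lastArrival ω t n ∈ ((rrOne N).state h₀ ω t).queue n
      · right
        simp only [hm, hq, true_and, if_true, lastSampled]
        have := hmem hq
        refine ⟨?_, hLs, fun h => hsucc (Or.inl ?_)⟩
        -- In both cases the delivered packet is no older than the current AoI, so the minimum is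
        -- the age of the packet.
        · rcases ih with ⟨h1, -, -⟩ | ⟨h1, h2, -⟩ <;> omega
        · by_contra ha
          exact h (hLn ha).symm
      -- The terminal is scheduled without its last arrival in store: either nothing has arrived
      -- yet, or that arrival has already been sampled and sampling it again changes nothing.
      · simp only [hm, hq, and_false, if_false, lastSampled, if_true]
        rcases ih with ⟨h1, h2, h3⟩ | ⟨h1, h2, h3⟩
        · left
          have hno : ∀ s < t, ω.1 s n = false := fun s hs => by
            by_contra h
            exact hq (h2 s hs (by simpa using h))
          refine ⟨by omega, fun s hs ha => hsucc (Or.inl ?_), fun s hs => hno s (by omega)⟩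
          rcases Nat.lt_succ_iff_lt_or_eq.1 hs with h | rfl
          · simp [hno s h] at ha
          · exact ha
        · right
          have h4 : lastSampled ω t n = lastArrival ω t n := by
            by_contra h
            exact hq (h3 h)
          refine ⟨by omega, hLs, fun h => hsucc (Or.inl ?_)⟩
          by_contra ha
          exact h (hLn ha).symm
    · simp only [hm, false_and, if_false, lastSampled, rrTau]
      rcases ih with ⟨h1, h2, h3⟩ | ⟨h1, h2, h3⟩
      · left
        refine ⟨by omega, fun s hs ha => hsucc ?_, fun s hs => h3 s (by omega)⟩
        rcases Nat.lt_succ_iff_lt_or_eq.1 hs with h | rfl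
        · exact Or.inr ⟨h2 s h ha, hm⟩
        · exact Or.inl ha
      · right
        refine ⟨by omega, by omega, fun h => hsucc ?_⟩
        by_cases ha : ω.1 t n = true
        · exact Or.inl ha
        · rw [hLn ha] at h
          exact Or.inr ⟨h3 h, hm⟩

/-- Once the first arrival at `n` has been sampled, the AoI is the time since the last scheduling
plus the age of the last arrival at that time. -/
theorem aoi_rrOne_of_arrival (h₀ : Fin N → ℕ) (ω : Outcome N) (n : Fin N) {s t : ℕ}
    (hs : ω.1 s n = true) (ht : s + N + 1 ≤ t) :
    ((rrOne N).state h₀ ω (t + 1)).aoi n = rrTau N (t + 1) n +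
      (t - rrTau N (t + 1) n - lastArrival ω (t - rrTau N (t + 1) n) n) := by
  -- As every terminal is scheduled within `N` slots, the arrival in slot `s` precedes the last
  -- scheduling, which rules out the first alternative of the invariant.
  have hτ := rrTau_le (t + 1) n
  have hL := lastArrival_le ω (t - rrTau N (t + 1) n) n
  rcases rrOne_invariant h₀ ω (t + 1) n with ⟨-, -, h⟩ | ⟨h, -, -⟩
  · simp [h s (by omega)] at hs
  · rw [lastSampled_succ_eq] at h
    omega

/-! ### Pathwise lower bounds for arbitrary policies. -/

theorem le_lastArrival_of_mem_queue (π : Policy N) (h₀ : Fin N → ℕ) (ω : Outcome N) (t : ℕ)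
    (n : Fin N) {s : ℕ} (hs : s ∈ (π.state h₀ ω t).queue n) : s ≤ lastArrival ω t n := by
  induction t with
  | zero => simp [Policy.state] at hs
  | succ t ih =>
    have h := lastArrival_le_succ ω t n
    simp only [Policy.state, Policy.step, Finset.mem_sdiff, Finset.mem_union] at hs
    rcases hs.1 with h1 | h1
    · refine (ih ?_).trans h
      split_ifs at h1
      · exact Finset.mem_of_mem_erase h1
      · exact h1
    · split_ifs at h1 with ha
      · simp only [lastArrival, ha, if_true]
        exact (Finset.mem_singleton.1 h1).le
      · simp at h1

/-- Under every policy, the AoI is at least the age of the last arrival. -/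
theorem le_aoi_add_lastArrival (π : Policy N) (h₀ : Fin N → ℕ) (ω : Outcome N) (t : ℕ)
    (n : Fin N) : t ≤ (π.state h₀ ω t).aoi n + lastArrival ω t n + 1 := by
  induction t with
  | zero => omega
  | succ t ih =>
    have h := lastArrival_le_succ ω t n
    simp only [Policy.state, Policy.step, Policy.reduction]
    split_ifs with hd
    · have := le_lastArrival_of_mem_queue π h₀ ω t n hd.2
      omega
    · omega

/-- Since at most one packet is delivered per slot, at most `k` terminals have AoI at most `k`. -/
theorem card_aoi_le (π : Policy N) (h₀ : Fin N → ℕ) (ω : Outcome N) {t k : ℕ} (hk : k < t) :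
    (Finset.univ.filter fun n => (π.state h₀ ω t).aoi n ≤ k).card ≤ k := by
  induction t generalizing k with
  | zero => omega
  | succ t ih =>
    rcases k with _ | k
    -- After any slot every AoI is at least `1`. At time `0` this may fail, as initial AoIs are
    -- arbitrary; this is why `k < t` is required.
    · simp [Policy.state, Policy.step]
    · have ih := ih (show k < t by omega)
      have hnd : ∀ n, ¬ π.Delivers ω t (π.state h₀ ω t) n → (π.state h₀ ω (t + 1)).aoi n ≤ k + 1 →
          (π.state h₀ ω t).aoi n ≤ k := by
        intro n hn h
        simp only [Policy.state, Policy.step, Policy.reduction, hn, if_false] at h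
        omega
      -- A terminal with AoI at most `k + 1` after the slot either had AoI at most `k` before it or
      -- is the one terminal that delivered.
      by_cases hd : ∃ n, π.Delivers ω t (π.state h₀ ω t) n
      · obtain ⟨m, hm⟩ := hd
        refine le_trans (Finset.card_le_card fun n hn => ?_)
          ((Finset.card_insert_le m
            (Finset.univ.filter fun n => (π.state h₀ ω t).aoi n ≤ k)).trans (by omega))
        simp only [Finset.mem_filter, Finset.mem_univ, true_and, Finset.mem_insert] at hn ⊢
        by_cases h : π.Delivers ω t (π.state h₀ ω t) n
        · exact Or.inl (Finset.singleton_injective (h.1.symm.trans hm.1))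
        · exact Or.inr (hnd n h hn)
      · rw [not_exists] at hd
        refine le_trans (Finset.card_le_card fun n hn => ?_) (ih.trans (Nat.le_succ k))
        simp only [Finset.mem_filter, Finset.mem_univ, true_and] at hn ⊢
        exact hnd n (hd n) hn

/-- Summation by layers: for each `k < N` at least `N - k` terminals have AoI above `k`, and each
AoI is at least the number of levels `k < N` below it. -/
theorem sum_range_add_le_sum_aoi (π : Policy N) (h₀ : Fin N → ℕ) (ω : Outcome N) {t : ℕ}
    (ht : N ≤ t) : ∑ k ∈ Finset.range N, k + N ≤ ∑ n, (π.state h₀ ω t).aoi n := by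
  have h1 : ∀ n, ∑ k ∈ Finset.range N, (if k < (π.state h₀ ω t).aoi n then 1 else 0)
      ≤ (π.state h₀ ω t).aoi n := by
    intro n
    rw [Finset.sum_boole]
    calc _ ≤ (Finset.range ((π.state h₀ ω t).aoi n)).card :=
          Finset.card_le_card fun k hk => by simp at hk ⊢; exact hk.2
      _ = _ := Finset.card_range _
  have h2 : ∀ k ∈ Finset.range N,
      N - k ≤ ∑ n, (if k < (π.state h₀ ω t).aoi n then 1 else 0) := by
    intro k hk
    have h3 := card_aoi_le π h₀ ω (lt_of_lt_of_le (Finset.mem_range.1 hk) ht)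
    have h4 := Finset.card_filter_add_card_filter_not (s := (Finset.univ : Finset (Fin N)))
      (fun n => (π.state h₀ ω t).aoi n ≤ k)
    simp only [not_le, Finset.card_univ, Fintype.card_fin] at h4
    rw [Finset.sum_boole]
    simp only [Nat.cast_id]
    omega
  calc ∑ k ∈ Finset.range N, k + N = ∑ k ∈ Finset.range N, (k + 1) := by
        simp [Finset.sum_add_distrib]
    _ = ∑ k ∈ Finset.range N, (N - k) := by
        rw [← Finset.sum_range_reflect]
        refine Finset.sum_congr rfl fun k hk => ?_
        have := Finset.mem_range.1 hk
        omega
    _ ≤ ∑ k ∈ Finset.range N, ∑ n, (if k < (π.state h₀ ω t).aoi n then 1 else 0) :=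
        Finset.sum_le_sum h2
    _ = ∑ n, ∑ k ∈ Finset.range N, (if k < (π.state h₀ ω t).aoi n then 1 else 0) :=
        Finset.sum_comm
    _ ≤ _ := Finset.sum_le_sum fun n _ => h1 n

/-! ### The time average of RR-ONE. -/

/-- The time-average AoI of RR-ONE in closed form. -/
noncomputable def rrMean (lam : Fin N → I) : ℝ :=
  ((∑ k ∈ Finset.range N, (k : ℝ)) + ∑ n, 1 / (lam n : ℝ)) / N

theorem avgAoI_eq_ofReal (π : Policy N) (h₀ : Fin N → ℕ) (ω : Outcome N) (T : ℕ) :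
    π.avgAoI h₀ ω T = ENNReal.ofReal
      ((∑ t ∈ Finset.range T, ∑ n, ((π.state h₀ ω (t + 1)).aoi n : ℝ)) / T / N) := by
  rcases Nat.eq_zero_or_pos T with rfl | hT
  · simp [Policy.avgAoI]
  rcases Nat.eq_zero_or_pos N with rfl | hN
  · simp [Policy.avgAoI]
  have hT' : (0 : ℝ) < T := by exact_mod_cast hT
  have hN' : (0 : ℝ) < N := by exact_mod_cast hN
  have h : ∑ t ∈ Finset.range T, ∑ n, ((π.state h₀ ω (t + 1)).aoi n : ℝ)
      = ((∑ t ∈ Finset.range T, ∑ n, (π.state h₀ ω (t + 1)).aoi n : ℕ) : ℝ) := by push_cast; rfl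
  rw [div_div, ENNReal.ofReal_div_of_pos (by positivity), ENNReal.ofReal_mul hT'.le, h]
  simp only [ENNReal.ofReal_natCast, Policy.avgAoI]
  push_cast
  rfl

theorem tendsto_average_of_eventually_eq {f g : ℕ → ℝ} {l : ℝ} (h : ∀ᶠ t in atTop, f t = g t)
    (hg : Tendsto (fun T : ℕ => (∑ t ∈ Finset.range T, g t) / T) atTop (𝓝 l)) :
    Tendsto (fun T : ℕ => (∑ t ∈ Finset.range T, f t) / T) atTop (𝓝 l) := by
  have h1 : Tendsto (fun t => f t - g t) atTop (𝓝 0) :=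
    tendsto_const_nhds.congr' (h.mono fun t ht => (sub_eq_zero.2 ht).symm)
  have h2 := h1.cesaro.add hg
  rw [zero_add] at h2
  refine h2.congr fun T => ?_
  rw [Finset.sum_sub_distrib]
  ring

theorem tendsto_average_const (c : ℝ) :
    Tendsto (fun T : ℕ => (∑ _t ∈ Finset.range T, c) / T) atTop (𝓝 c) := by
  refine (tendsto_const_nhds (x := c)).cesaro.congr fun T => ?_
  ring

/-- Without arrivals the age at time `t` would be `t`, with averages `(T - 1) / 2`, contradicting
the strong law. -/
theorem ae_exists_arrival (lam : Fin N → I) (n : Fin N) (hn : 0 < lam n) :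
    ∀ᵐ ω ∂(law lam), ∃ s, ω.1 s n = true := by
  filter_upwards [ae_tendsto_average_age lam n hn id 0 (by intros; simp only [id]; omega)] with ω hω
  by_contra! hno
  have h0 : ∀ t, lastArrival ω t n = 0 := by
    intro t
    induction t with
    | zero => rfl
    | succ t ih => simp [lastArrival, hno t, ih]
  refine not_tendsto_nhds_of_tendsto_atTop ?_ _ hω
  have h1 : Tendsto (fun T : ℕ => ((T : ℝ) - 1) / 2) atTop atTop :=
    (tendsto_atTop_add_const_right _ (-1) tendsto_natCast_atTop_atTop).atTop_div_const two_pos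
  refine h1.congr' ?_
  filter_upwards [eventually_gt_atTop 0] with T hT
  have hT' : (0 : ℝ) < T := by exact_mod_cast hT
  have h2 : (∑ t ∈ Finset.range T, (t : ℝ)) * 2 = T * (T - 1) := by
    have h3 := Finset.sum_range_id_mul_two T
    have h4 : ((T - 1 : ℕ) : ℝ) = T - 1 := by
      rw [Nat.cast_sub hT]; simp
    rw [← h4]
    simpa only [Nat.cast_sum, Nat.cast_mul, Nat.cast_ofNat] using congrArg (Nat.cast : ℕ → ℝ) h3
  simp only [id, h0, Nat.sub_zero]
  rw [eq_div_iff hT'.ne']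
  linarith

theorem ae_tendsto_avgAoI_rrOne (lam : Fin N → I) (h₀ : Fin N → ℕ) (hlam : ∀ n, 0 < lam n) :
    ∀ᵐ ω ∂(law lam), Tendsto (fun T => (rrOne N).avgAoI h₀ ω T) atTop
      (𝓝 (ENNReal.ofReal (rrMean lam))) := by
  have h1 : ∀ᵐ ω ∂(law lam), ∀ n, ∃ s, ω.1 s n = true :=
    ae_all_iff.2 fun n => ae_exists_arrival lam n (hlam n)
  -- The age is sampled at the last scheduling slot, which lags behind `t` by at most `N`; hence the
  -- slack `D = N`.
  have h2 := ae_all_iff.2 fun n => ae_tendsto_average_age lam n (hlam n)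
    (fun t => t - rrTau N (t + 1) n) N fun s t hst => by
      have := rrTau_le (t + 1) n
      omega
  filter_upwards [h1, h2] with ω hω1 hω2
  simp_rw [avgAoI_eq_ofReal]
  refine ENNReal.tendsto_ofReal (Tendsto.div_const ?_ _)
  refine tendsto_average_of_eventually_eq (g := fun t => (∑ k ∈ Finset.range N, (k : ℝ)) + ∑ n,
    ((t - rrTau N (t + 1) n - lastArrival ω (t - rrTau N (t + 1) n) n : ℕ) : ℝ)) ?_ ?_
  · have h3 : ∀ᶠ t in atTop, ∀ n, ((rrOne N).state h₀ ω (t + 1)).aoi n = rrTau N (t + 1) n +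
        (t - rrTau N (t + 1) n - lastArrival ω (t - rrTau N (t + 1) n) n) := by
      refine eventually_all.2 fun n => ?_
      obtain ⟨s, hs⟩ := hω1 n
      exact (eventually_ge_atTop (s + N + 1)).mono fun t ht => aoi_rrOne_of_arrival h₀ ω n hs ht
    filter_upwards [h3, eventually_ge_atTop N] with t ht htN
    have h4 := sum_rrTau (N := N) (t := t + 1) (by omega)
    simp_rw [ht]
    push_cast
    rw [Finset.sum_add_distrib]
    congr 1
    simpa only [Nat.cast_sum] using congrArg (Nat.cast : ℕ → ℝ) h4
  · have h3 := (tendsto_average_const (∑ k ∈ Finset.range N, (k : ℝ))).add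
      (tendsto_finsetSum Finset.univ fun n _ => hω2 n)
    refine h3.congr fun T => ?_
    rw [Finset.sum_add_distrib, add_div]
    congr 1
    rw [Finset.sum_comm, Finset.sum_div]

theorem hRR_eq (lam : Fin N → I) (h₀ : Fin N → ℕ) (hlam : ∀ n, 0 < lam n) :
    hRR lam h₀ = ENNReal.ofReal (rrMean lam) := by
  have h : (fun ω => liminf (fun T => (rrOne N).avgAoI h₀ ω T) atTop) =ᵐ[law lam]
      fun _ => ENNReal.ofReal (rrMean lam) :=
    (ae_tendsto_avgAoI_rrOne lam h₀ hlam).mono fun ω hω => hω.liminf_eq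
  rw [hRR, Policy.timeAvgAoI, lintegral_congr_ae h]
  simp

/-! ### Bounds for the optimal time average. -/

theorem hOpt_le_hRR {B : ℕ∞} (hB : 1 ≤ B) (lam : Fin N → I) (h₀ : Fin N → ℕ) :
    hOpt B lam h₀ ≤ hRR lam h₀ :=
  iInf_le (fun π : {π : Policy N // π.FitsBuffer B} => π.1.timeAvgAoI lam h₀)
    ⟨rrOne N, rrOne_fitsBuffer hB⟩

/-- An almost sure lower bound for the total AoI in every slot that holds for all policies gives a
lower bound for the optimal time average. -/
theorem ofReal_le_hOpt {B : ℕ∞} {lam : Fin N → I} {h₀ : Fin N → ℕ} {g : Outcome N → ℕ → ℝ} {l : ℝ}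
    (hle : ∀ (π : Policy N) ω t, g ω t ≤ ∑ n, ((π.state h₀ ω (t + 1)).aoi n : ℝ))
    (hg : ∀ᵐ ω ∂(law lam),
      Tendsto (fun T : ℕ => (∑ t ∈ Finset.range T, g ω t) / T) atTop (𝓝 l)) :
    ENNReal.ofReal (l / N) ≤ hOpt B lam h₀ := by
  refine le_iInf fun π => ?_
  calc ENNReal.ofReal (l / N) = ∫⁻ _, ENNReal.ofReal (l / N) ∂(law lam) := by simp
    _ ≤ _ := ?_
  refine lintegral_mono_ae ?_
  filter_upwards [hg] with ω hω
  rw [← (ENNReal.tendsto_ofReal (hω.div_const (N : ℝ))).liminf_eq]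
  refine liminf_le_liminf (Eventually.of_forall fun T => ?_)
  rw [avgAoI_eq_ofReal]
  have := Finset.sum_le_sum fun t (_ : t ∈ Finset.range T) => hle π.1 ω t
  refine ENNReal.ofReal_le_ofReal ?_
  gcongr

theorem sum_range_cast (N : ℕ) : ∑ k ∈ Finset.range N, (k : ℝ) = N * (N - 1) / 2 := by
  induction N with
  | zero => simp
  | succ N ih => rw [Finset.sum_range_succ, ih]; push_cast; ring

/-- The bound is `(N + 1) / 2`. The counting argument applies only from time `N` on; the earlier
slots are bounded by `0` and do not affect the average. -/
theorem ofReal_half_le_hOpt (B : ℕ∞) (lam : Fin N → I) (h₀ : Fin N → ℕ) :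
    ENNReal.ofReal ((∑ k ∈ Finset.range N, (k : ℝ) + N) / N) ≤ hOpt B lam h₀ := by
  refine ofReal_le_hOpt
    (g := fun _ t => if N ≤ t + 1 then ∑ k ∈ Finset.range N, (k : ℝ) + N else 0) ?_ ?_
  · intro π ω t
    split_ifs with h
    · simpa only [Nat.cast_sum, Nat.cast_add] using
        (Nat.cast_le (α := ℝ)).2 (sum_range_add_le_sum_aoi π h₀ ω h)
    · positivity
  · refine ae_of_all _ fun ω => tendsto_average_of_eventually_eq ?_ (tendsto_average_const _)
    filter_upwards [eventually_ge_atTop N] with t ht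
    rw [if_pos (by omega)]

/-- Only the AoI of terminal `i` is kept. The loss of `1` reflects that a packet counts as having
age `0` in the slot after its arrival. -/
theorem ofReal_inv_sub_one_le_hOpt (B : ℕ∞) (lam : Fin N → I) (h₀ : Fin N → ℕ) (i : Fin N)
    (hi : 0 < lam i) : ENNReal.ofReal ((1 / (lam i : ℝ) - 1) / N) ≤ hOpt B lam h₀ := by
  refine ofReal_le_hOpt (g := fun ω t => ((t + 1 - lastArrival ω (t + 1) i : ℕ) : ℝ) - 1) ?_ ?_
  · intro π ω t
    have h1 := le_aoi_add_lastArrival π h₀ ω (t + 1) i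
    have h2 : t + 1 - lastArrival ω (t + 1) i ≤ (π.state h₀ ω (t + 1)).aoi i + 1 := by omega
    have h3 : ((t + 1 - lastArrival ω (t + 1) i : ℕ) : ℝ)
        ≤ ((π.state h₀ ω (t + 1)).aoi i : ℝ) + 1 := by exact_mod_cast h2
    have h4 := Finset.single_le_sum (f := fun n => ((π.state h₀ ω (t + 1)).aoi n : ℝ))
      (fun n _ => by positivity) (Finset.mem_univ i)
    linarith
  · filter_upwards [ae_tendsto_average_age lam i hi (fun t => t + 1) 0 (by intros; omega)] with ω hω
    refine (hω.sub (tendsto_average_const 1)).congr fun T => ?_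
    rw [Finset.sum_sub_distrib, sub_div]

/-! ### The two scaling limits. -/

theorem tendsto_hRR_div_and_hOpt_div {B : ℕ∞} (hB : 1 ≤ B) (lam : (N : ℕ) → Fin N → I)
    (h₀ : (N : ℕ) → Fin N → ℕ) (hlam : ∀ N n, 0 < lam N n)
    (h : Tendsto (fun N : ℕ => (∑ n, 1 / (lam N n : ℝ)) / (N : ℝ) ^ 2) atTop (𝓝 0)) :
    Tendsto (fun N : ℕ => hRR (lam N) (h₀ N) / N) atTop (𝓝 (1 / 2)) ∧
      Tendsto (fun N : ℕ => hOpt B (lam N) (h₀ N) / N) atTop (𝓝 (1 / 2)) := by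
  have half : (1 / 2 : ℝ≥0∞) = ENNReal.ofReal (1 / 2) := by
    rw [ENNReal.ofReal_div_of_pos two_pos]; simp
  have hdiv : ∀ (N : ℕ) (x : ℝ), 0 < N →
      ENNReal.ofReal x / N = ENNReal.ofReal (x / N) := fun N x hN => by
    rw [ENNReal.ofReal_div_of_pos (by exact_mod_cast hN), ENNReal.ofReal_natCast]
  have h1 : Tendsto (fun N : ℕ => hRR (lam N) (h₀ N) / N) atTop (𝓝 (1 / 2)) := by
    rw [half]
    have h2 : Tendsto (fun N : ℕ => 1 / 2 - 1 / 2 * (1 / (N : ℝ))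
        + (∑ n, 1 / (lam N n : ℝ)) / (N : ℝ) ^ 2) atTop (𝓝 (1 / 2)) := by
      simpa only [mul_zero, sub_zero, add_zero] using
        (((tendsto_one_div_atTop_nhds_zero_nat (𝕜 := ℝ)).const_mul (1 / 2)).const_sub
          (1 / 2)).add h
    refine (ENNReal.tendsto_ofReal h2).congr' ?_
    filter_upwards [eventually_gt_atTop 0] with N hN
    have hN' : (0 : ℝ) < N := by exact_mod_cast hN
    rw [hRR_eq _ _ (hlam N), hdiv _ _ hN, rrMean, sum_range_cast]
    congr 1
    field_simp
  refine ⟨h1, ?_⟩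
  have h2 : Tendsto (fun N : ℕ => ENNReal.ofReal (1 / 2 + 1 / 2 * (1 / (N : ℝ)))) atTop
      (𝓝 (1 / 2)) := by
    rw [half]
    refine ENNReal.tendsto_ofReal ?_
    simpa only [mul_zero, add_zero] using
      ((tendsto_one_div_atTop_nhds_zero_nat (𝕜 := ℝ)).const_mul (1 / 2)).const_add (1 / 2)
  -- The optimum divided by `N` lies between `1 / 2 + 1 / (2 * N)` and the value for RR-ONE.
  refine tendsto_of_tendsto_of_tendsto_of_le_of_le' h2 h1 ?_
    (Eventually.of_forall fun N => ENNReal.div_le_div_right (hOpt_le_hRR hB _ _) _)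
  filter_upwards [eventually_gt_atTop 0] with N hN
  have hN' : (0 : ℝ) < N := by exact_mod_cast hN
  refine le_trans (le_of_eq ?_) (ENNReal.div_le_div_right (ofReal_half_le_hOpt B (lam N) (h₀ N)) _)
  rw [hdiv _ _ hN, sum_range_cast]
  congr 1
  field_simp
  ring

theorem rrMean_update (lam : Fin N → I) (i : Fin N) (p : I) :
    rrMean (Function.update lam i p) = ((∑ k ∈ Finset.range N, (k : ℝ)) + (1 / (p : ℝ) +
      ∑ j ∈ {i}ᶜ, 1 / (lam j : ℝ))) / N := by
  rw [rrMean, Fintype.sum_eq_add_sum_compl i, Function.update_self]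
  congr 3
  refine Finset.sum_congr rfl fun j hj => ?_
  rw [Function.update_of_ne (by simpa using hj)]

theorem tendsto_mul_hRR_and_mul_hOpt {B : ℕ∞} (hB : 1 ≤ B) (i : Fin N) (lam : Fin N → I)
    (h₀ : Fin N → ℕ) (hlam : ∀ j, j ≠ i → 0 < lam j) :
    Tendsto (fun p : I => ENNReal.ofReal p * hRR (Function.update lam i p) h₀)
        (comap (fun p : I => 1 / (p : ℝ)) atTop) (𝓝 (1 / N)) ∧
      Tendsto (fun p : I => ENNReal.ofReal p * hOpt B (Function.update lam i p) h₀)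
        (comap (fun p : I => 1 / (p : ℝ)) atTop) (𝓝 (1 / N)) := by
  have hN : (0 : ℝ) < N := by exact_mod_cast i.pos
  have hlim : (1 / N : ℝ≥0∞) = ENNReal.ofReal (1 / N) := by
    rw [ENNReal.ofReal_div_of_pos hN]; simp
  have hp0 : Tendsto (fun p : I => (p : ℝ)) (comap (fun p : I => 1 / (p : ℝ)) atTop) (𝓝 0) := by
    refine (tendsto_inv_atTop_zero.comp
      (tendsto_comap (f := fun p : I => 1 / (p : ℝ)) (x := atTop))).congr fun p => ?_
    simp
  -- The filter excludes `p = 0`, because `1 / 0 = 0` is not large.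
  have hpos : ∀ᶠ p : I in comap (fun p : I => 1 / (p : ℝ)) atTop, (0 : ℝ) < p := by
    have := (tendsto_comap (f := fun p : I => 1 / (p : ℝ)) (x := atTop)).eventually
      (eventually_gt_atTop 0)
    exact this.mono fun p hp => one_div_pos.1 hp
  have h1 : Tendsto (fun p : I => ENNReal.ofReal p * hRR (Function.update lam i p) h₀)
      (comap (fun p : I => 1 / (p : ℝ)) atTop) (𝓝 (1 / N)) := by
    rw [hlim]
    have h2 : Tendsto (fun p : I => ((p : ℝ) * ((∑ k ∈ Finset.range N, (k : ℝ))
        + ∑ j ∈ {i}ᶜ, 1 / (lam j : ℝ)) + 1) / N) (comap (fun p : I => 1 / (p : ℝ)) atTop)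
        (𝓝 (1 / N)) := by
      simpa using ((hp0.mul_const ((∑ k ∈ Finset.range N, (k : ℝ))
        + ∑ j ∈ {i}ᶜ, 1 / (lam j : ℝ))).add_const 1).div_const (N : ℝ)
    refine (ENNReal.tendsto_ofReal h2).congr' ?_
    filter_upwards [hpos] with p hp
    have hall : ∀ n, 0 < Function.update lam i p n := by
      intro n
      by_cases hn : n = i
      · rw [hn, Function.update_self]
        exact hp
      · rw [Function.update_of_ne hn]
        exact hlam n hn
    rw [hRR_eq _ _ hall, rrMean_update, ← ENNReal.ofReal_mul hp.le]
    congr 1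
    field_simp
    ring
  refine ⟨h1, ?_⟩
  have h2 : Tendsto (fun p : I => ENNReal.ofReal ((1 - (p : ℝ)) / N))
      (comap (fun p : I => 1 / (p : ℝ)) atTop) (𝓝 (1 / N)) := by
    rw [hlim]
    refine ENNReal.tendsto_ofReal ?_
    simpa using (hp0.const_sub 1).div_const (N : ℝ)
  -- Multiplied by `p`, the lower bound for terminal `i` is `(1 - p) / N`, while the closed form for
  -- RR-ONE is `1 / N` plus a constant multiple of `p`.
  refine tendsto_of_tendsto_of_tendsto_of_le_of_le' h2 h1 ?_
    (Eventually.of_forall fun p => mul_le_mul_right (hOpt_le_hRR hB _ _) _)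
  filter_upwards [hpos] with p hp
  have h3 := ofReal_inv_sub_one_le_hOpt B (Function.update lam i p) h₀ i
    (by rw [Function.update_self]; exact hp)
  rw [Function.update_self] at h3
  refine le_trans (le_of_eq ?_) (mul_le_mul_right h3 _)
  rw [← ENNReal.ofReal_mul hp.le]
  congr 1
  field_simp

end Uplink

open Uplink
theorem theorem2 (B : ℕ∞) (hB : 1 ≤ B) :
    -- RR-ONE is an admissible policy and its time-average AoI exists as an almost sure limit
    (∀ (N : ℕ) (lam : Fin N → I) (h₀ : Fin N → ℕ), (∀ n, 0 < lam n) →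
      (rrOne N).FitsBuffer B ∧
      ∀ᵐ ω ∂(law lam),
        Tendsto (fun T => (rrOne N).avgAoI h₀ ω T) atTop (𝓝 (hRR lam h₀))) ∧
    -- scaling in the number of terminals
    (∀ (lam : (N : ℕ) → Fin N → I) (h₀ : (N : ℕ) → Fin N → ℕ),
      (∀ N n, 0 < lam N n) →
      Tendsto (fun N : ℕ => (∑ n, 1 / (lam N n : ℝ)) / (N : ℝ) ^ 2) atTop (𝓝 0) →
      Tendsto (fun N : ℕ => hRR (lam N) (h₀ N) / N) atTop (𝓝 (1 / 2)) ∧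
      Tendsto (fun N : ℕ => hOpt B (lam N) (h₀ N) / N) atTop (𝓝 (1 / 2))) ∧
    -- scaling in the mean inter-arrival time of one terminal, everything else being fixed
    (∀ (N : ℕ) (i : Fin N) (lam : Fin N → I) (h₀ : Fin N → ℕ), (∀ j, j ≠ i → 0 < lam j) →
      Tendsto (fun p : I => ENNReal.ofReal p * hRR (Function.update lam i p) h₀)
        (comap (fun p : I => 1 / (p : ℝ)) atTop) (𝓝 (1 / N)) ∧
      Tendsto (fun p : I => ENNReal.ofReal p * hOpt B (Function.update lam i p) h₀)
        (comap (fun p : I => 1 / (p : ℝ)) atTop) (𝓝 (1 / N))) := by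
  refine ⟨fun N lam h₀ hlam => ⟨rrOne_fitsBuffer hB, ?_⟩,
    fun lam h₀ hlam h => tendsto_hRR_div_and_hOpt_div hB lam h₀ hlam h,
    fun N i lam h₀ hlam => tendsto_mul_hRR_and_mul_hOpt hB i lam h₀ hlam⟩
  rw [hRR_eq lam h₀ hlam]
  exact ae_tendsto_avgAoI_rrOne lam h₀ hlam
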